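/- An MV-algebra is an algebra $(M;\oplus,\neg,0)$ such that, with $1:=\neg 0$, for all $x,y,z$: $x\oplus y=y\oplus x$, $x\oplus(y\oplus z)=(x\oplus y)\oplus z$, $x\oplus 0=x$, $\neg\neg x=x$, $x\oplus 1=1$ and $\neg(\neg x\oplus y)\oplus y=\neg(\neg y\oplus x)\oplus x$. It is ordered by $x\le y\iff \neg x\oplus y=1$; a linearly ordered MV-algebra is called an MV-chain. The sets $[0,1]\subseteq\mathbb R$ and $\mathbb Q\cap[0,1]$ are MV-algebras under $x\oplus y=\min\{x+y,1\}$, $\neg x=1-x$. An embedding is an injective map preserving $\oplus$, $\neg$ and $0$. A proper filter $D$ over a set $I$ is $\alpha$-regular if there is $E\subseteq D$ with $|E|=\alpha$ such that each $i\in I$ belongs to only finitely many $e\in E$. Theorem. Let $\alpha$ be an infinite cardinal and let $I$ be the set of all finite subsets of $\alpha$. There are ultrafilters on $I$ that contain all the sets $\{Y\in I: X\subseteq Y\}$, $X\in I$. Every such ultrafilter $U$ is $\alpha$-regular, and for every linearly ordered MV-algebra $\mathbf M$ with $|M|\le\alpha$: 1. there are finite MV-chains $\mathbf A_X$ ($X\in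 I$) such that $\mathbf M$ can be embedded into the ultraproduct $(\prod_{X\in I}\mathbf A_X)/U$; 2. if $0\neq 1$ in $\mathbf M$, then $\mathbf M$ can be embedded into the ultrapower $(\prod_{X\in I}\mathbb Q\cap[0,1])/U$; 3. if $0\neq 1$ in $\mathbf M$, then $\mathbf M$ can be embedded into the ultrapower $(\prod_{X\in I}[0,1])/U$. -/

import Mathlib

universe u v

/-- An MV-algebra: an algebra `(A, ⊕, ¬, 0)` satisfying (MV1)-(MV6), with `1 := ¬ 0`. -/
class MVAlgebra (A : Type*) where
  oplus : A → A → A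
  neg : A → A
  zero : A
  oplus_comm : ∀ x y, oplus x y = oplus y x
  oplus_assoc : ∀ x y z, oplus x (oplus y z) = oplus (oplus x y) z
  oplus_zero : ∀ x, oplus x zero = x
  neg_neg : ∀ x, neg (neg x) = x
  oplus_one : ∀ x, oplus x (neg zero) = neg zero
  lukasiewicz : ∀ x y, oplus (neg (oplus (neg x) y)) y = oplus (neg (oplus (neg y) x)) x

namespace MVAlgebra

/-- The top element `1 := ¬ 0`. -/
def one {A : Type*} [MVAlgebra A] : A := neg zero

/-- The natural order: `x ≤ y` iff `¬ x ⊕ y = 1`. -/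
def le {A : Type*} [MVAlgebra A] (x y : A) : Prop := oplus (neg x) y = one

/-- An MV-chain is a linearly ordered MV-algebra. The natural order of an MV-algebra is always a
partial order, so only totality has to be required. The one-element MV-algebra is included. -/
def IsChain (A : Type*) [MVAlgebra A] : Prop := ∀ x y : A, le x y ∨ le y x

/-- An embedding of MV-algebras: an injective map preserving `⊕`, `¬` and `0`. -/
structure Embedding (A B : Type*) [MVAlgebra A] [MVAlgebra B] where
  toFun : A → B
  injective : Function.Injective toFun
  map_oplus : ∀ x y, toFun (oplus x y) = oplus (toFun x) (toFun y)
  map_neg : ∀ x, toFun (neg x) = neg (toFun x)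
  map_zero : toFun zero = zero

/-- The MV-algebra on the unit interval of a linearly ordered field: `x ⊕ y = min (x + y) 1`,
`¬ x = 1 - x`. For `ℝ` it is the standard MV-algebra `[0,1]`, for `ℚ` it is `ℚ ∩ [0,1]`. -/
instance unitInterval {K : Type*} [Field K] [LinearOrder K] [IsStrictOrderedRing K] :
    MVAlgebra (Set.Icc (0 : K) 1) where
  oplus x y := ⟨min (x.1 + y.1) 1, le_min (add_nonneg x.2.1 y.2.1) zero_le_one, min_le_right _ _⟩
  neg x := ⟨1 - x.1, sub_nonneg.2 x.2.2, sub_le_self _ x.2.1⟩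
  zero := ⟨0, le_refl _, zero_le_one⟩
  oplus_comm x y := Subtype.ext (by simp only [add_comm])
  oplus_assoc x y z := Subtype.ext (by
    obtain ⟨x, hx⟩ := x
    obtain ⟨y, hy⟩ := y
    obtain ⟨z, hz⟩ := z
    grind)
  oplus_zero x := Subtype.ext (by simp [x.2.2])
  neg_neg x := Subtype.ext (by simp)
  oplus_one x := Subtype.ext (by simp [x.2.1])
  lukasiewicz x y := Subtype.ext (by
    obtain ⟨x, hx⟩ := x
    obtain ⟨y, hy⟩ := y
    grind)

/-- The ultraproduct `(∏ i, A i) / U`: functions modulo equality on a set of `U`, with the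
operations computed coordinatewise on representatives. -/
instance ultraproduct {I : Type*} (U : Ultrafilter I) (A : I → Type*) [∀ i, MVAlgebra (A i)] :
    MVAlgebra ((U : Filter I).Product A) where
  oplus := Quotient.map₂ (sa := Filter.productSetoid (U : Filter I) A)
    (sb := Filter.productSetoid (U : Filter I) A) (sc := Filter.productSetoid (U : Filter I) A)
    (fun f g i => oplus (f i) (g i)) (fun f f' hf g g' hg => by
      filter_upwards [hf, hg] with i h₁ h₂
      rw [h₁, h₂])
  neg := Quotient.map (sa := Filter.productSetoid (U : Filter I) A)
    (sb := Filter.productSetoid (U : Filter I) A)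
    (fun f i => neg (f i)) (fun f f' hf => by
      filter_upwards [hf] with i h
      rw [h])
  zero := Quotient.mk (Filter.productSetoid (U : Filter I) A) (fun _ => zero)
  oplus_comm := by
    rintro ⟨x⟩ ⟨y⟩
    exact congrArg (Quotient.mk _) (funext fun i => oplus_comm _ _)
  oplus_assoc := by
    rintro ⟨x⟩ ⟨y⟩ ⟨z⟩
    exact congrArg (Quotient.mk _) (funext fun i => oplus_assoc _ _ _)
  oplus_zero := by
    rintro ⟨x⟩
    exact congrArg (Quotient.mk _) (funext fun i => oplus_zero _)
  neg_neg := by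
    rintro ⟨x⟩
    exact congrArg (Quotient.mk _) (funext fun i => neg_neg _)
  oplus_one := by
    rintro ⟨x⟩
    exact congrArg (Quotient.mk _) (funext fun i => oplus_one _)
  lukasiewicz := by
    rintro ⟨x⟩ ⟨y⟩
    exact congrArg (Quotient.mk _) (funext fun i => lukasiewicz _ _)

end MVAlgebra

/-- A filter `D` over `I` is `α`-regular if it is proper and there is `E ⊆ D` of cardinality `α`
such that each `i ∈ I` belongs to only finitely many `e ∈ E`. -/
def IsAlphaRegular (α : Cardinal.{u}) {I : Type u} (D : Filter I) : Prop :=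
  D.NeBot ∧ ∃ E : Set (Set I), (∀ e ∈ E, e ∈ D) ∧ Cardinal.mk E = α ∧
    ∀ i : I, {e ∈ E | i ∈ e}.Finite

/-- The set of all finite subsets of the cardinal `α`, which is regarded as an initial ordinal. -/
abbrev FinSubsets (α : Cardinal.{u}) : Type u := Finset α.ord.ToType

/-- `U` contains every cone `{Y | X ⊆ Y}`, where `X` is a finite subset of `α`. -/
def ContainsCones (α : Cardinal.{u}) (U : Ultrafilter (FinSubsets α)) : Prop :=
  ∀ X : FinSubsets α, {Y : FinSubsets α | X ⊆ Y} ∈ U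

/-! An ultraproduct over the finite subsets of `α` only sees finite pieces of `M`. Index `M`
injectively by `α`; each `X` then selects a finite subset of `M`, and the cones put every element of
`M` in this subset for `U`-almost all `X`. So it suffices to map each finite subset, injectively and
respecting the operations where they stay inside it, into a finite chain
(`nonempty_embedding_ultraproduct`).

For a finite `S` in a nontrivial chain, Chang's group presents the chain as an interval `[0, e]` of
an ordered abelian group (`IsChain.exists_group`). Only finitely many strict inequalities matter on
`S`, and a homomorphism to `ℝ` can preserve these (`exists_addMonoidHom_real_pos`). Simultaneous
Diophantine approximation then turns the real coordinates into integers in `[0, N]`. Dividing by `N`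
carries the finite chains into `ℚ ∩ [0,1]` and `[0,1]`, which gives all three embeddings. -/

namespace MVAlgebra

local infixl:65 " ∔ " => oplus

/-! ### Identities of MV-algebras. -/

section Identities

variable {A : Type*} [MVAlgebra A]

theorem zero_oplus (x : A) : zero ∔ x = x := by rw [oplus_comm, oplus_zero]

theorem oplus_left_comm (x y z : A) : x ∔ (y ∔ z) = y ∔ (x ∔ z) := by
  rw [oplus_assoc, oplus_comm x y, oplus_assoc]

theorem oplus_one' (x : A) : x ∔ one = one := oplus_one x

theorem one_oplus (x : A) : one ∔ x = one := by rw [oplus_comm, oplus_one']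

theorem neg_zero : neg (zero : A) = one := rfl

theorem neg_one : neg (one : A) = zero := neg_neg _

theorem neg_injective : Function.Injective (neg : A → A) :=
  Function.LeftInverse.injective neg_neg

theorem neg_oplus_self (x : A) : neg x ∔ x = one := by
  have h := lukasiewicz x one
  rwa [oplus_one', neg_one, zero_oplus, eq_comm] at h

theorem oplus_neg_self (x : A) : x ∔ neg x = one := by rw [oplus_comm, neg_oplus_self]

/-- The product `x ⊙ y = ¬ (¬ x ⊕ ¬ y)`. -/
def otimes (x y : A) : A := neg (neg x ∔ neg y)

local infixl:70 " ⊙ " => otimes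

theorem otimes_comm (x y : A) : x ⊙ y = y ⊙ x := by
  rw [otimes, otimes, oplus_comm]

theorem otimes_assoc (x y z : A) : x ⊙ (y ⊙ z) = x ⊙ y ⊙ z := by
  simp only [otimes, neg_neg, oplus_assoc]

theorem one_otimes (x : A) : one ⊙ x = x := by
  rw [otimes, neg_one, zero_oplus, neg_neg]

theorem otimes_one (x : A) : x ⊙ one = x := by rw [otimes_comm, one_otimes]

theorem neg_otimes_self (x : A) : neg x ⊙ x = zero := by
  rw [otimes, oplus_comm, neg_neg, neg_oplus_self, neg_one]

theorem eq_one_of_otimes_eq_one {x y : A} (h : x ⊙ y = one) : x = one := by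
  have h₁ : neg x ∔ neg y = zero := by rw [← neg_one, ← h, otimes, neg_neg]
  have h₂ : x ∔ (neg x ∔ neg y) = one := by rw [oplus_assoc, oplus_neg_self, one_oplus]
  rwa [h₁, oplus_zero] at h₂

/-- If `x ≤ y`, then `(y ⊖ x) ⊕ x = y`. -/
theorem le.sub_oplus {x y : A} (h : le x y) : neg (neg y ∔ x) ∔ x = y := by
  have h' : neg x ∔ y = one := h
  rw [← lukasiewicz, h', neg_one, zero_oplus]

theorem le_neg_comm {x y : A} (h : le x (neg y)) : le y (neg x) := by
  rw [le, oplus_comm]; exact h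

theorem le_oplus (x y : A) : le x (y ∔ x) := by
  rw [le, oplus_left_comm, neg_oplus_self, oplus_one']

/-- Both sides equal `¬ (¬ (x ⊕ y) ⊕ y ⊕ ¬ (y ⊕ z))`. In group terms, neither inner sum exceeds `1`,
and both sides are `x + y + z - 1` cut off at `0`. -/
theorem oplus_otimes_eq_otimes_oplus {x y z : A} (hxy : le x (neg y)) (hyz : le y (neg z)) :
    (x ∔ y) ⊙ z = x ⊙ (y ∔ z) := by
  have h₁ := hyz.sub_oplus
  have h₂ := (le_neg_comm hxy).sub_oplus
  rw [neg_neg] at h₁ h₂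
  rw [otimes, otimes, ← h₁, ← h₂, oplus_comm y z, ← oplus_assoc, oplus_comm y (neg (z ∔ y))]

/-- In group terms `x + y ≤ 1 ≤ y + z`, so no truncation occurs and both sides are `x + y + z - 1`.
-/
theorem oplus_otimes_eq_oplus_otimes {x y z : A} (hxy : le x (neg y)) (hzy : le (neg z) y) :
    (x ∔ y) ⊙ z = x ∔ y ⊙ z := by
  have hy : y ⊙ z ∔ neg z = y := hzy.sub_oplus
  have hz : y ⊙ z ∔ neg y = z := by
    have h : le (neg y) z := by
      rw [le, neg_neg, oplus_comm]
      rwa [le, neg_neg] at hzy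
    rw [otimes_comm]
    exact h.sub_oplus
  have hx := hxy.sub_oplus
  have hle : le (x ∔ y ⊙ z) z := by
    have h : neg (neg (neg y) ∔ x) ∔ (x ∔ y ⊙ z) = z := by
      rw [oplus_assoc, hx, oplus_comm, hz]
    have h' := le_oplus (x ∔ y ⊙ z) (neg (neg (neg y) ∔ x))
    rwa [h] at h'
  have hle' : le (neg z) (neg (x ∔ y ⊙ z)) := by rwa [le, neg_neg, oplus_comm]
  have h := hle'.sub_oplus
  rw [neg_neg, ← oplus_assoc, hy] at h
  rw [otimes, h, neg_neg]

theorem le_neg_of_oplus_ne_one (hA : IsChain A) {x y : A} (h : x ∔ y ≠ one) : le x (neg y) := by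
  refine (hA x (neg y)).resolve_right fun h' => h ?_
  rwa [le, neg_neg, oplus_comm] at h'

end Identities

-- Chang's group of an MV-chain.

local infixl:70 " ⊙ " => otimes

/-- The elements `n + x` of Chang's group of an MV-chain, where `n` is an integer and `x < 1`. -/
@[ext]
structure ChangGroup (A : Type*) [MVAlgebra A] where
  int : ℤ
  frac : A
  frac_ne_one : frac ≠ one

namespace ChangGroup

variable {A : Type*} [MVAlgebra A]

open scoped Classical in
/-- Addition with carry. -/
noncomputable instance : Add (ChangGroup A) where
  add a b :=
    if h : a.frac ∔ b.frac = one then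
      ⟨a.int + b.int + 1, a.frac ⊙ b.frac, fun h' => a.frac_ne_one (eq_one_of_otimes_eq_one h')⟩
    else ⟨a.int + b.int, a.frac ∔ b.frac, h⟩

theorem add_of_eq {a b : ChangGroup A} (h : a.frac ∔ b.frac = one) :
    a + b = ⟨a.int + b.int + 1, a.frac ⊙ b.frac,
      fun h' => a.frac_ne_one (eq_one_of_otimes_eq_one h')⟩ :=
  dif_pos h

theorem add_of_ne {a b : ChangGroup A} (h : a.frac ∔ b.frac ≠ one) :
    a + b = ⟨a.int + b.int, a.frac ∔ b.frac, h⟩ :=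
  dif_neg h

theorem int_add_int_le (a b : ChangGroup A) : a.int + b.int ≤ (a + b).int := by
  by_cases h : a.frac ∔ b.frac = one
  · rw [add_of_eq h]; simp
  · rw [add_of_ne h]

protected theorem add_comm (a b : ChangGroup A) : a + b = b + a := by
  by_cases h : a.frac ∔ b.frac = one
  · rw [add_of_eq h, add_of_eq (by rwa [oplus_comm])]
    ext
    · simp [add_comm]
    · exact otimes_comm _ _
  · rw [add_of_ne h, add_of_ne (by rwa [oplus_comm])]
    ext
    · simp [add_comm]
    · exact oplus_comm _ _

/-- Exactly one carry occurs on each side: in the outer sum on the left, in `b + c` on the right.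
Totality turns the absence of a carry in `a + b` into `a.frac ≤ ¬ b.frac`. -/
theorem add_assoc_of_ne_of_eq (hA : IsChain A) (a b c : ChangGroup A)
    (h₁ : a.frac ∔ b.frac ≠ one) (h₂ : b.frac ∔ c.frac = one) : a + b + c = a + (b + c) := by
  have key : (a.frac ∔ b.frac) ⊙ c.frac = a.frac ∔ b.frac ⊙ c.frac :=
    oplus_otimes_eq_oplus_otimes (le_neg_of_oplus_ne_one hA h₁)
      (by rwa [le, neg_neg, oplus_comm])
  rw [add_of_ne h₁, add_of_eq h₂, add_of_eq, add_of_ne]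
  · ext
    · dsimp only; ring
    · exact key
  · rw [← key]
    intro h
    rw [otimes_comm] at h
    exact c.frac_ne_one (eq_one_of_otimes_eq_one h)
  · dsimp only
    rw [← oplus_assoc, h₂, oplus_one']

protected theorem add_assoc (hA : IsChain A) (a b c : ChangGroup A) :
    a + b + c = a + (b + c) := by
  by_cases h₁ : a.frac ∔ b.frac = one <;> by_cases h₂ : b.frac ∔ c.frac = one
  -- Two inner carries: this is the de Morgan dual of the case with none.
  · have key : a.frac ⊙ b.frac ∔ c.frac = a.frac ∔ b.frac ⊙ c.frac := by
      have h := oplus_otimes_eq_otimes_oplus (x := neg a.frac) (y := neg b.frac) (z := neg c.frac)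
        (by rwa [le, neg_neg, neg_neg]) (by rwa [le, neg_neg, neg_neg])
      apply neg_injective
      simpa only [otimes, neg_neg] using h
    rw [add_of_eq h₁, add_of_eq h₂]
    by_cases h : a.frac ⊙ b.frac ∔ c.frac = one
    · rw [add_of_eq h, add_of_eq (by rwa [key] at h)]
      ext
      · dsimp only; ring
      · exact (otimes_assoc _ _ _).symm
    · rw [add_of_ne h, add_of_ne (by rwa [key] at h)]
      ext
      · dsimp only; ring
      · exact key
  · rw [ChangGroup.add_comm a b, ChangGroup.add_comm _ c, ChangGroup.add_comm b c,
      ChangGroup.add_comm a (c + b)]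
    rw [oplus_comm] at h₁ h₂
    exact (add_assoc_of_ne_of_eq hA c b a h₂ h₁).symm
  · exact add_assoc_of_ne_of_eq hA a b c h₁ h₂
  · rw [add_of_ne h₁, add_of_ne h₂]
    by_cases h : a.frac ∔ b.frac ∔ c.frac = one
    · rw [add_of_eq h, add_of_eq (by rwa [← oplus_assoc] at h)]
      ext
      · dsimp only; ring
      · exact oplus_otimes_eq_otimes_oplus (le_neg_of_oplus_ne_one hA h₁)
          (le_neg_of_oplus_ne_one hA h₂)
    · rw [add_of_ne h, add_of_ne (by rwa [← oplus_assoc] at h)]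
      ext
      · dsimp only; ring
      · exact (oplus_assoc _ _ _).symm

open scoped Classical in
/-- The negative: `-(n + x) = (-n - 1) + ¬ x` for `x ≠ 0`. -/
noncomputable instance : Neg (ChangGroup A) where
  neg a :=
    if h : a.frac = zero then ⟨-a.int, a.frac, a.frac_ne_one⟩
    else ⟨-a.int - 1, neg a.frac, fun h' => h (neg_injective h')⟩

theorem neg_of_eq {a : ChangGroup A} (h : a.frac = zero) : -a = ⟨-a.int, a.frac, a.frac_ne_one⟩ :=
  dif_pos h

theorem neg_of_ne {a : ChangGroup A} (h : a.frac ≠ zero) :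
    -a = ⟨-a.int - 1, neg a.frac, fun h' => h (neg_injective h')⟩ :=
  dif_neg h

/-- The group structure of Chang's group of a nontrivial MV-chain. -/
noncomputable abbrev addCommGroup (hA : IsChain A) (h01 : (zero : A) ≠ one) :
    AddCommGroup (ChangGroup A) :=
  letI : Zero (ChangGroup A) := ⟨⟨0, zero, h01⟩⟩
  have zero_add' (a : ChangGroup A) : 0 + a = a := by
    have h : zero ∔ a.frac ≠ one := by rw [zero_oplus]; exact a.frac_ne_one
    refine (add_of_ne h).trans ?_
    ext
    · exact zero_add _
    · exact zero_oplus _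
  { add_assoc := ChangGroup.add_assoc hA
    zero_add := zero_add'
    add_zero := fun a => by rw [ChangGroup.add_comm, zero_add']
    nsmul := nsmulRec
    zsmul := zsmulRec
    add_comm := ChangGroup.add_comm
    neg_add_cancel := fun a => by
      by_cases h : a.frac = zero
      · rw [neg_of_eq h, add_of_ne (by rw [h, oplus_zero]; exact h01)]
        ext
        · exact neg_add_cancel _
        · dsimp only
          rw [h, oplus_zero]
          rfl
      · rw [neg_of_ne h, add_of_eq (neg_oplus_self _)]
        ext
        · change -a.int - 1 + a.int + 1 = 0
          ring
        · exact neg_otimes_self _ }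

/-- Since `0 ≤ x < 1`, the element `n + x` should be nonnegative exactly when `0 ≤ n`. A carry only
raises the integer part, so this cone is closed under addition; negation sends `n` to `-n` or `-n -
1`, which makes the cone pointed and total. -/
theorem exists_linearOrder (hA : IsChain A) (h01 : (zero : A) ≠ one) :
    letI := addCommGroup hA h01
    ∃ (_ : LinearOrder (ChangGroup A)) (_ : IsOrderedAddMonoid (ChangGroup A)),
      ∀ a : ChangGroup A, 0 ≤ a ↔ 0 ≤ a.int := by
  classical
  let := addCommGroup hA h01
  let C : AddGroupCone (ChangGroup A) :=
    { carrier := {a | 0 ≤ a.int}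
      zero_mem' := le_refl (0 : ℤ)
      add_mem' := fun {a b} ha hb => (add_nonneg ha hb).trans (int_add_int_le a b)
      eq_zero_of_mem_of_neg_mem' := fun {a} ha hb => by
        change 0 ≤ a.int at ha
        change 0 ≤ (-a).int at hb
        by_cases h : a.frac = zero
        · rw [neg_of_eq h] at hb
          ext
          · change a.int = 0
            dsimp only at hb
            omega
          · exact h
        · rw [neg_of_ne h] at hb
          dsimp only at hb
          omega }
  have : HasMemOrNegMem C := ⟨fun a => by
    change 0 ≤ a.int ∨ 0 ≤ (-a).int
    by_cases h : a.frac = zero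
    · rw [neg_of_eq h]; dsimp only; omega
    · rw [neg_of_ne h]; dsimp only; omega⟩
  refine ⟨LinearOrder.mkOfAddGroupCone C, IsOrderedAddMonoid.mkOfCone C, fun a => ?_⟩
  change a - 0 ∈ C ↔ _
  rw [sub_zero]
  rfl

end ChangGroup

/-- An MV-chain is an interval `[0, u]` of a linearly ordered abelian group. -/
theorem IsChain.exists_group {A : Type v} [MVAlgebra A] (hA : IsChain A)
    (h01 : (zero : A) ≠ one) :
    ∃ (G : Type v) (_ : AddCommGroup G) (_ : LinearOrder G) (_ : IsOrderedAddMonoid G)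
      (e : G) (j : A → G), Function.Injective j ∧ 0 < e ∧ j zero = 0 ∧
        (∀ x, 0 ≤ j x) ∧ (∀ x, j (neg x) = e - j x) ∧
        ∀ x y, j (x ∔ y) = min (j x + j y) e := by
  classical
  let := ChangGroup.addCommGroup hA h01
  obtain ⟨_, _, hnonneg⟩ := ChangGroup.exists_linearOrder hA h01
  let e : ChangGroup A := ⟨1, zero, h01⟩
  -- The fractional part must differ from `1`, so `1` itself goes to `1 + 0`.
  let j : A → ChangGroup A := fun x => if h : x = one then e else ⟨0, x, h⟩
  have j_one : j one = e := dif_pos rfl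
  have j_of_ne {x : A} (h : x ≠ one) : j x = ⟨0, x, h⟩ := dif_neg h
  have j_nonneg (x : A) : 0 ≤ j x := by
    rw [hnonneg]
    by_cases h : x = one
    · rw [h, j_one]; exact zero_le_one
    · rw [j_of_ne h]
  have j_zero : j zero = 0 := j_of_ne h01
  have add_of_eq (x y : A) (h : x ∔ y = one) : j x + j y = e + j (x ⊙ y) := by
    by_cases hx : x = one
    · rw [hx, j_one, one_otimes]
    by_cases hy : y = one
    · rw [hy, j_one, otimes_one, add_comm]
    rw [j_of_ne hx, j_of_ne hy, j_of_ne fun h' => hx (eq_one_of_otimes_eq_one h'),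
      ChangGroup.add_of_eq h, ChangGroup.add_of_ne]
    · ext
      · rfl
      · exact (zero_oplus _).symm
    · change zero ∔ x ⊙ y ≠ one
      rw [zero_oplus]
      exact fun h' => hx (eq_one_of_otimes_eq_one h')
  have j_neg (x : A) : j (neg x) = e - j x := by
    rw [eq_sub_iff_add_eq, add_of_eq _ _ (neg_oplus_self x), neg_otimes_self, j_zero, add_zero]
  have j_le (x : A) : j x ≤ e := by
    rw [← sub_nonneg, ← j_neg]; exact j_nonneg _
  refine ⟨ChangGroup A, _, _, inferInstance, e, j, fun x y hxy => ?_, ?_, j_zero, j_nonneg, j_neg,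
    fun x y => ?_⟩
  · by_cases hx : x = one <;> by_cases hy : y = one
    · rw [hx, hy]
    · rw [hx, j_one, j_of_ne hy] at hxy
      exact absurd (congrArg ChangGroup.int hxy) one_ne_zero
    · rw [hy, j_one, j_of_ne hx] at hxy
      exact absurd (congrArg ChangGroup.int hxy) zero_ne_one
    · rw [j_of_ne hx, j_of_ne hy] at hxy
      exact congrArg ChangGroup.frac hxy
  · refine lt_of_le_of_ne (j_one ▸ j_nonneg one) fun h => ?_
    exact absurd (congrArg ChangGroup.int h) zero_ne_one
  · by_cases h : x ∔ y = one
    · rw [h, j_one, add_of_eq x y h, min_eq_right]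
      exact le_add_of_nonneg_right (j_nonneg _)
    · have hx : x ≠ one := by rintro rfl; exact h (one_oplus y)
      have hy : y ≠ one := by rintro rfl; exact h (oplus_one' x)
      have hadd : j x + j y = j (x ∔ y) := by
        rw [j_of_ne hx, j_of_ne hy, j_of_ne h, ChangGroup.add_of_ne h]
        rfl
      rw [hadd, min_eq_left (j_le _)]

end MVAlgebra

/-! ### Real and integer approximation. -/

/-- Any finite set of positive elements of a linearly ordered abelian group can be made positive by
a homomorphism to `ℝ`. -/
theorem exists_addMonoidHom_real_pos {G : Type*} [AddCommGroup G] [LinearOrder G]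
    [IsOrderedAddMonoid G] (F : Finset G) :
    ∃ φ : G →+ ℝ, ∀ g ∈ F, 0 < g → 0 < φ g := by
  classical
  obtain ⟨f, hf, -⟩ := hahnEmbedding_isOrderedAddMonoid G
  let coeff (c : FiniteArchimedeanClass G) : G →+ ℝ :=
    { toFun := fun g => (ofLex (f g)).coeff c
      map_zero' := by simp
      map_add' := by simp }
  -- In the lexicographic order on Hahn series the leading coefficient decides the sign.
  have hlead (g : G) (hg : 0 < g) : ∃ c, (∀ d < c, coeff d g = 0) ∧ 0 < coeff c g := by
    have h : 0 < f g := by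
      refine lt_of_le_of_ne ?_ ?_
      · simpa using f.monotone' hg.le
      · intro h
        exact hg.ne (hf (by simpa using h))
    obtain ⟨c, h₁, h₂⟩ := (HahnSeries.lt_iff _ _).1 h
    exact ⟨c, fun d hd => (h₁ d hd).symm, h₂⟩
  choose lead hlead_zero hlead_pos using hlead
  have main (C : Finset (FiniteArchimedeanClass G)) :
      ∃ φ : G →+ ℝ, ∀ g ∈ F, ∀ hg : 0 < g, lead g hg ∈ C → 0 < φ g := by
    induction C using Finset.induction_on_min with
    | empty => exact ⟨0, by simp⟩
    | insert c C hc ih =>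
      obtain ⟨φ, hφ⟩ := ih
      -- The new class `c` precedes all of `C`. A large multiple of its coefficient makes the
      -- elements led by `c` positive, and this coefficient vanishes on those led by classes in `C`.
      have hev : ∀ᶠ K : ℝ in Filter.atTop, ∀ g ∈ F, 0 < coeff c g → 0 < K * coeff c g + φ g := by
        rw [Filter.eventually_all_finset]
        intro g _
        by_cases hg : 0 < coeff c g
        · have h : Filter.Tendsto (fun K : ℝ => K * coeff c g + φ g) Filter.atTop Filter.atTop :=
            Filter.tendsto_atTop_add_const_right _ _ (Filter.tendsto_id.atTop_mul_const hg)
          filter_upwards [h.eventually_gt_atTop 0] with K hK _ using hK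
        · exact Filter.Eventually.of_forall fun K h => absurd h hg
      obtain ⟨K, hK⟩ := hev.exists
      refine ⟨(AddMonoidHom.mulLeft K).comp (coeff c) + φ, fun g hgF hg hgC => ?_⟩
      change 0 < K * coeff c g + φ g
      rcases Finset.mem_insert.1 hgC with h | h
      · exact hK g hgF (h ▸ hlead_pos g hg)
      · rw [hlead_zero g hg c (hc _ h), mul_zero, zero_add]
        exact hφ g hgF hg h
  obtain ⟨φ, hφ⟩ := main ((F.filter (0 < ·)).attach.image
    fun g : {g // g ∈ F.filter (0 < ·)} => lead g.1 (Finset.mem_filter.1 g.2).2)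
  exact ⟨φ, fun g hgF hg => hφ g hgF hg (Finset.mem_image.2
    ⟨⟨g, Finset.mem_filter.2 ⟨hgF, hg⟩⟩, Finset.mem_attach _ _, rfl⟩)⟩

/-- Simultaneous Diophantine approximation: finitely many reals have arbitrarily large common
multiples that are close to integers. -/
theorem exists_nat_forall_abs_mul_sub_round_lt {κ : Type*} [Finite κ] (f : κ → ℝ) (N₀ : ℕ)
    {ε : ℝ} (hε : 0 < ε) :
    ∃ N : ℕ, N₀ ≤ N ∧ ∀ i, |N * f i - round (N * f i)| < ε := by
  cases nonempty_fintype κ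
  let x : ℕ → κ → ℝ := fun n i => Int.fract (n * f i)
  have hcomp : IsCompact (Set.univ.pi fun _ : κ => Set.Icc (0 : ℝ) 1) :=
    isCompact_univ_pi fun _ => isCompact_Icc
  -- Along a convergent subsequence the fractional parts are eventually close to each other; the
  -- difference of two such indices is the required `N`.
  obtain ⟨a, -, σ, hσ, hlim⟩ := hcomp.tendsto_subseq (x := x)
    fun n i _ => ⟨Int.fract_nonneg _, (Int.fract_lt_one _).le⟩
  obtain ⟨m, hm⟩ := Metric.cauchySeq_iff.1 hlim.cauchySeq ε hε
  have hle : σ m + N₀ ≤ σ (m + N₀) := by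
    have := hσ.add_le_nat N₀ m
    rw [add_comm m N₀]; omega
  refine ⟨σ (m + N₀) - σ m, by omega, fun i => ?_⟩
  have hd := (dist_le_pi_dist _ _ i).trans_lt (hm (m + N₀) (by omega) m le_rfl)
  refine (round_le _ (⌊(σ (m + N₀) : ℝ) * f i⌋ - ⌊(σ m : ℝ) * f i⌋)).trans_lt ?_
  rw [Real.dist_eq] at hd
  refine lt_of_eq_of_lt (congrArg abs ?_) hd
  simp only [Function.comp, x, Int.fract]
  push_cast [Nat.cast_sub (show σ m ≤ σ (m + N₀) by omega)]
  ring

/-! ### Partial embeddings into finite chains. -/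

namespace MVAlgebra

local infixl:65 " ∔ " => oplus

/-- The map `f` is injective on `S` and preserves the operations as far as `S` is closed under
them. -/
structure IsPartialEmbedding {A B : Type*} [MVAlgebra A] [MVAlgebra B] (S : Set A) (f : A → B) :
    Prop where
  injOn : Set.InjOn f S
  map_oplus : ∀ x ∈ S, ∀ y ∈ S, x ∔ y ∈ S → f (x ∔ y) = f x ∔ f y
  map_neg : ∀ x ∈ S, neg x ∈ S → f (neg x) = neg (f x)
  map_zero : zero ∈ S → f zero = zero

/-- The finite MV-chain with `N + 1` elements: `x ⊕ y = min (x + y) N`, `¬ x = N - x`. -/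
instance intInterval (N : ℕ) : MVAlgebra (Set.Icc (0 : ℤ) N) where
  oplus x y := ⟨min (x.1 + y.1) N, le_min (add_nonneg x.2.1 y.2.1) (Int.natCast_nonneg N),
    min_le_right _ _⟩
  neg x := ⟨N - x.1, sub_nonneg.2 x.2.2, sub_le_self _ x.2.1⟩
  zero := ⟨0, le_refl _, Int.natCast_nonneg N⟩
  oplus_comm x y := Subtype.ext (by simp only [add_comm])
  oplus_assoc x y z := Subtype.ext (by
    obtain ⟨x, hx⟩ := x
    obtain ⟨y, hy⟩ := y
    obtain ⟨z, hz⟩ := z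
    grind)
  oplus_zero x := Subtype.ext (by simp [x.2.2])
  neg_neg x := Subtype.ext (by simp)
  oplus_one x := Subtype.ext (by simp [x.2.1])
  lukasiewicz x y := Subtype.ext (by
    obtain ⟨x, hx⟩ := x
    obtain ⟨y, hy⟩ := y
    grind)

theorem isChain_intInterval (N : ℕ) : IsChain (Set.Icc (0 : ℤ) N) := by
  have key (x y : Set.Icc (0 : ℤ) N) (h : x.1 ≤ y.1) : le x y := by
    refine Subtype.ext ?_
    change min ((N - x.1) + y.1) (N : ℤ) = N - 0
    omega
  exact fun x y => (le_total x.1 y.1).imp (key x y) (key y x)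

/-- The `N`-fold dilation embeds the chain with `N + 1` elements into the unit interval. -/
def intIntervalEmbedding (K : Type*) [Field K] [LinearOrder K] [IsStrictOrderedRing K] {N : ℕ}
    (hN : 0 < N) : Embedding (Set.Icc (0 : ℤ) N) (Set.Icc (0 : K) 1) :=
  have hN' : (0 : K) < N := Nat.cast_pos.2 hN
  { toFun := fun x => ⟨(x.1 : K) / N, div_nonneg (Int.cast_nonneg x.2.1) hN'.le,
      (div_le_one hN').2 (by exact_mod_cast x.2.2)⟩
    injective := fun x y h => by
      have h' : (x.1 : K) / N = (y.1 : K) / N := congrArg Subtype.val h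
      rw [div_left_inj' hN'.ne'] at h'
      exact Subtype.ext (by exact_mod_cast h')
    map_oplus := fun x y => Subtype.ext (by
      change ((min (x.1 + y.1) (N : ℤ) : ℤ) : K) / N = min ((x.1 : K) / N + (y.1 : K) / N) 1
      rw [Int.cast_min, ← min_div_div_right hN'.le, Int.cast_natCast, div_self hN'.ne',
        Int.cast_add, add_div])
    map_neg := fun x => Subtype.ext (by
      change (((N : ℤ) - x.1 : ℤ) : K) / N = 1 - (x.1 : K) / N
      rw [Int.cast_sub, Int.cast_natCast, sub_div, div_self hN'.ne'])
    map_zero := Subtype.ext (by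
      change ((0 : ℤ) : K) / N = 0
      rw [Int.cast_zero, zero_div]) }

/-- A finite subset of a nontrivial MV-chain has real coordinates in `[0, 1]`. -/
theorem IsChain.exists_real {A : Type*} [MVAlgebra A] (hA : IsChain A)
    (h01 : (zero : A) ≠ one) {S : Set A} (hS : S.Finite) :
    ∃ f : A → ℝ, Set.InjOn f S ∧ (∀ x ∈ S, f x ∈ Set.Icc 0 1) ∧ f zero = 0 ∧
      (∀ x, f (neg x) = 1 - f x) ∧
      ∀ x ∈ S, ∀ y ∈ S, f (x ∔ y) = min (f x + f y) 1 := by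
  classical
  obtain ⟨G, _, _, _, e, j, j_inj, e_pos, j_zero, j_nonneg, j_neg, j_oplus⟩ := hA.exists_group h01
  lift S to Finset A using hS
  -- Positivity of these elements records the bounds `0` and `e`, the order on `S`, and which sums
  -- are truncated.
  obtain ⟨φ, hφ⟩ := exists_addMonoidHom_real_pos
    (insert e (S.image j ∪ S.image (fun x => e - j x) ∪
      (S ×ˢ S).image (fun p => j p.1 - j p.2) ∪ (S ×ˢ S).image (fun p => j p.1 + j p.2 - e) ∪
        (S ×ˢ S).image fun p => e - (j p.1 + j p.2)))
  have φe : 0 < φ e := hφ e (by simp) e_pos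
  have φ_nonneg {g : G} (h : 0 < g → 0 < φ g) (hg : 0 ≤ g) : 0 ≤ φ g := by
    rcases hg.eq_or_lt with rfl | hg
    · rw [_root_.map_zero]
    · exact (h hg).le
  have φ_j (x : A) (hx : x ∈ S) : 0 < j x → 0 < φ (j x) := hφ _ (by simp; grind)
  have φ_sub (x : A) (hx : x ∈ S) : 0 < e - j x → 0 < φ (e - j x) := hφ _ (by simp; grind)
  have φ_diff (x : A) (hx : x ∈ S) (y : A) (hy : y ∈ S) :
      0 < j x - j y → 0 < φ (j x - j y) := hφ _ (by simp; grind)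
  have φ_sum (x : A) (hx : x ∈ S) (y : A) (hy : y ∈ S) :
      0 < j x + j y - e → 0 < φ (j x + j y - e) := hφ _ (by simp; grind)
  have φ_gap (x : A) (hx : x ∈ S) (y : A) (hy : y ∈ S) :
      0 < e - (j x + j y) → 0 < φ (e - (j x + j y)) := hφ _ (by simp; grind)
  have φ_lt (x : A) (hx : x ∈ S) (y : A) (hy : y ∈ S) (h : j y < j x) :
      φ (j y) / φ e < φ (j x) / φ e := by
    have h := φ_diff x hx y hy (sub_pos.2 h)
    rw [_root_.map_sub, sub_pos] at h
    exact div_lt_div_of_pos_right h φe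
  refine ⟨fun x => φ (j x) / φ e, fun x hx y hy hxy => ?_, fun x hx => ⟨?_, ?_⟩, ?_, fun x => ?_,
    fun x hx y hy => ?_⟩
  · rcases lt_trichotomy (j x) (j y) with h | h | h
    · exact absurd hxy (φ_lt y hy x hx h).ne
    · exact j_inj h
    · exact absurd hxy (φ_lt x hx y hy h).ne'
  · exact div_nonneg (φ_nonneg (φ_j x hx) (j_nonneg x)) φe.le
  · rw [div_le_one φe, ← sub_nonneg, ← _root_.map_sub]
    refine φ_nonneg (φ_sub x hx) ?_
    rw [← j_neg]
    exact j_nonneg _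
  · simp [j_zero]
  · simp only [j_neg, _root_.map_sub, sub_div, div_self φe.ne']
  · simp only [j_oplus]
    rcases le_or_gt (j x + j y) e with h | h
    · have h' : φ (j x) / φ e + φ (j y) / φ e ≤ 1 := by
        rw [← add_div, div_le_one φe, ← _root_.map_add, ← sub_nonneg, ← _root_.map_sub]
        exact φ_nonneg (φ_gap x hx y hy) (sub_nonneg.2 h)
      rw [min_eq_left h, min_eq_left h', _root_.map_add, add_div]
    · have h' := φ_sum x hx y hy (sub_pos.2 h)
      rw [min_eq_right h.le, div_self φe.ne', min_eq_right]
      rw [← add_div, one_le_div φe, ← _root_.map_add, ← sub_nonneg, ← _root_.map_sub]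
      exact h'.le

/-- Finite subsets of a nontrivial MV-chain embed partially into finite MV-chains. -/
theorem IsChain.exists_isPartialEmbedding {A : Type*} [MVAlgebra A] (hA : IsChain A)
    (h01 : (zero : A) ≠ one) {S : Set A} (hS : S.Finite) :
    ∃ N : ℕ, 0 < N ∧ ∃ k : A → Set.Icc (0 : ℤ) N, IsPartialEmbedding S k := by
  obtain ⟨f, f_inj, f_mem, f_zero, f_neg, f_oplus⟩ := hA.exists_real h01 hS
  have hev : ∀ᶠ N : ℕ in Filter.atTop, ∀ x ∈ S, ∀ y ∈ S, f x < f y → 1 ≤ N * (f y - f x) := by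
    rw [Filter.eventually_all_finite hS]
    intro x _
    rw [Filter.eventually_all_finite hS]
    intro y _
    by_cases h : f x < f y
    · have hlim : Filter.Tendsto (fun N : ℕ => N * (f y - f x)) Filter.atTop Filter.atTop :=
        tendsto_natCast_atTop_atTop.atTop_mul_const (sub_pos.2 h)
      filter_upwards [hlim.eventually_ge_atTop 1] with N hN _ using hN
    · exact Filter.Eventually.of_forall fun N h' => absurd h' h
  obtain ⟨N₀, hN₀⟩ := Filter.eventually_atTop.1 hev
  have : Finite S := hS
  obtain ⟨N, hN, happrox⟩ := exists_nat_forall_abs_mul_sub_round_lt (fun x : S => f x)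
    (max N₀ 1) (show (0 : ℝ) < 1 / 6 by norm_num)
  have hsep := hN₀ N ((le_max_left _ _).trans hN)
  have hNpos : 0 < N := (le_max_right _ _).trans hN
  let r : A → ℤ := fun x => round (N * f x)
  have hr (x : A) (hx : x ∈ S) : |N * f x - r x| < 1 / 6 := happrox ⟨x, hx⟩
  have hNle {t : ℝ} (ht : t ≤ 1) : N * t ≤ N := mul_le_of_le_one_right (Nat.cast_nonneg N) ht
  have r_mem (x : A) (hx : x ∈ S) : r x ∈ Set.Icc (0 : ℤ) N := by
    have h := abs_lt.1 (hr x hx)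
    have h₀ : 0 ≤ N * f x := mul_nonneg (Nat.cast_nonneg N) (f_mem x hx).1
    have h₁ := hNle (f_mem x hx).2
    have h₂ : (-1 : ℝ) < r x := by linarith [h.2]
    have h₃ : (r x : ℝ) < N + 1 := by linarith [h.1]
    have h₂' : -1 < r x := by exact_mod_cast h₂
    have h₃' : r x < N + 1 := by exact_mod_cast h₃
    exact ⟨by omega, by omega⟩
  have r_lt (x : A) (hx : x ∈ S) (y : A) (hy : y ∈ S) (h : f x < f y) : r x < r y := by
    have h₁ := abs_lt.1 (hr x hx)
    have h₂ := abs_lt.1 (hr y hy)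
    have h₃ := hsep x hx y hy h
    have : (r x : ℝ) < r y := by linarith [h₁.1, h₂.2]
    exact_mod_cast this
  -- The projection matters only outside `S`; on `S` the rounded values already lie in `[0, N]`.
  let k : A → Set.Icc (0 : ℤ) N := fun x => Set.projIcc 0 (N : ℤ) (Int.natCast_nonneg N) (r x)
  have hk (x : A) (hx : x ∈ S) : k x = ⟨r x, r_mem x hx⟩ := Set.projIcc_of_mem _ (r_mem x hx)
  refine ⟨N, hNpos, k, fun x hx y hy hxy => ?_, fun x hx y hy hxy => ?_, fun x hx hx' => ?_,
    fun h => ?_⟩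
  · rw [hk x hx, hk y hy, Subtype.mk.injEq] at hxy
    rcases lt_trichotomy (f x) (f y) with h | h | h
    · exact absurd hxy (r_lt x hx y hy h).ne
    · exact f_inj hx hy h
    · exact absurd hxy (r_lt y hy x hx h).ne'
  · rw [hk x hx, hk y hy, hk _ hxy]
    refine Subtype.ext ?_
    change r (x ∔ y) = min (r x + r y) N
    have h₁ := abs_lt.1 (hr x hx)
    have h₂ := abs_lt.1 (hr y hy)
    have h₃ := abs_lt.1 (hr _ hxy)
    rw [f_oplus x hx y hy] at h₃
    rcases le_total (f x + f y) 1 with h | h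
    · rw [min_eq_left h] at h₃
      have h₄ : (r (x ∔ y) : ℝ) < r x + r y + 1 := by linarith [h₁.1, h₂.1, h₃.1]
      have h₅ : (r x + r y : ℝ) < r (x ∔ y) + 1 := by linarith [h₁.2, h₂.2, h₃.2]
      have h₄' : r (x ∔ y) < r x + r y + 1 := by exact_mod_cast h₄
      have h₅' : r x + r y < r (x ∔ y) + 1 := by exact_mod_cast h₅
      have h₆ := (r_mem _ hxy).2
      omega
    · rw [min_eq_right h, mul_one] at h₃
      have h₄ : (N : ℝ) < r (x ∔ y) + 1 := by linarith [h₃.2]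
      have h₅ : (N : ℝ) ≤ N * (f x + f y) := le_mul_of_one_le_right (Nat.cast_nonneg N) h
      have h₆ : (N : ℝ) < r x + r y + 1 := by linarith [h₁.2, h₂.2]
      have h₄' : (N : ℤ) < r (x ∔ y) + 1 := by exact_mod_cast h₄
      have h₆' : (N : ℤ) < r x + r y + 1 := by exact_mod_cast h₆
      have h₇ := (r_mem _ hxy).2
      omega
  · rw [hk x hx, hk _ hx']
    refine Subtype.ext ?_
    change r (neg x) = N - r x
    have h₁ := abs_lt.1 (hr x hx)
    have h₂ := abs_lt.1 (hr _ hx')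
    rw [f_neg] at h₂
    have h₃ : (r (neg x) + r x : ℝ) < N + 1 := by linarith [h₁.1, h₂.1]
    have h₄ : (N : ℝ) < r (neg x) + r x + 1 := by linarith [h₁.2, h₂.2]
    have h₃' : r (neg x) + r x < N + 1 := by exact_mod_cast h₃
    have h₄' : (N : ℤ) < r (neg x) + r x + 1 := by exact_mod_cast h₄
    omega
  · rw [hk _ h]
    refine Subtype.ext ?_
    change round (N * f zero) = 0
    rw [f_zero, mul_zero, round_zero]

/-! ### Passage to ultraproducts. -/

/-- Partial embeddings on sets that eventually contain each element yield an embedding into the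
ultraproduct. -/
theorem nonempty_embedding_ultraproduct {I : Type*} (U : Ultrafilter I) {A : Type*} [MVAlgebra A]
    {B : I → Type*} [∀ i, MVAlgebra (B i)] {S : I → Set A} (hS : ∀ x, ∀ᶠ i in U, x ∈ S i)
    {f : ∀ i, A → B i} (hf : ∀ i, IsPartialEmbedding (S i) (f i)) :
    Nonempty (Embedding A ((U : Filter I).Product B)) := by
  refine ⟨⟨fun x => Quotient.mk (Filter.productSetoid (U : Filter I) B) fun i => f i x,
    fun x y hxy => ?_, fun x y => Quotient.sound ?_, fun x => Quotient.sound ?_,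
    Quotient.sound ?_⟩⟩
  · have h : ∀ᶠ i in U, f i x = f i y := Quotient.exact hxy
    obtain ⟨i, hi, hx, hy⟩ := (h.and ((hS x).and (hS y))).exists
    exact (hf i).injOn hx hy hi
  · filter_upwards [hS x, hS y, hS (x ∔ y)] with i hx hy hxy
    exact (hf i).map_oplus x hx y hy hxy
  · filter_upwards [hS x, hS (neg x)] with i hx hx'
    exact (hf i).map_neg x hx hx'
  · filter_upwards [hS zero] with i h
    exact (hf i).map_zero h

theorem IsPartialEmbedding.comp {A B C : Type*} [MVAlgebra A] [MVAlgebra B] [MVAlgebra C]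
    {S : Set A} (g : Embedding B C) {f : A → B} (hf : IsPartialEmbedding S f) :
    IsPartialEmbedding S (g.toFun ∘ f) where
  injOn := g.injective.comp_injOn hf.injOn
  map_oplus x hx y hy hxy := by
    rw [Function.comp, hf.map_oplus x hx y hy hxy, g.map_oplus]
    rfl
  map_neg x hx hx' := by
    rw [Function.comp, hf.map_neg x hx hx', g.map_neg]
    rfl
  map_zero h := by rw [Function.comp, hf.map_zero h, g.map_zero]

theorem subsingleton_of_zero_eq_one {A : Type*} [MVAlgebra A] (h : (zero : A) = one) :
    Subsingleton A :=
  ⟨fun x y => by rw [← oplus_zero x, ← oplus_zero y, h, oplus_one', oplus_one']⟩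

end MVAlgebra

theorem exists_containsCones (α : Cardinal.{u}) :
    ∃ U : Ultrafilter (FinSubsets α), ContainsCones α U := by
  exact ⟨Ultrafilter.of Filter.atTop, fun X => Ultrafilter.of_le _ (Filter.mem_atTop X)⟩

/-- The cones over singletons form the family: `Y` lies in the cone over `{a}` only for its finitely
many elements `a`. -/
theorem ContainsCones.isAlphaRegular {α : Cardinal.{u}} {U : Ultrafilter (FinSubsets α)}
    (hU : ContainsCones α U) : IsAlphaRegular α (U : Filter (FinSubsets α)) := by
  let cone : α.ord.ToType → Set (FinSubsets α) := fun a => {Y | {a} ⊆ Y}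
  have hcone : Function.Injective cone := fun a b hab => by
    have h : ({a} : FinSubsets α) ∈ cone b := hab ▸ Finset.Subset.refl _
    exact (Finset.singleton_subset_singleton.1 h).symm
  refine ⟨U.neBot, Set.range cone, ?_, ?_, fun Y => ?_⟩
  · rintro _ ⟨a, rfl⟩
    exact hU {a}
  · rw [Cardinal.mk_range_eq _ hcone, Cardinal.mk_ord_toType]
  · refine (Y.finite_toSet.image cone).subset ?_
    rintro _ ⟨⟨a, rfl⟩, ha⟩
    exact ⟨a, Finset.singleton_subset_iff.1 ha, rfl⟩

theorem theorem10 (α : Cardinal.{u}) (hα : Cardinal.aleph0 ≤ α) :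
    (∃ U : Ultrafilter (FinSubsets α), ContainsCones α U) ∧
    ∀ U : Ultrafilter (FinSubsets α), ContainsCones α U →
      IsAlphaRegular α (U : Filter (FinSubsets α)) ∧
      ∀ (M : Type v) [MVAlgebra M], MVAlgebra.IsChain M →
        Cardinal.lift.{u} (Cardinal.mk M) ≤ Cardinal.lift.{v} α →
        (∃ (A : FinSubsets α → Type) (_ : ∀ X, MVAlgebra (A X)),
          (∀ X, Finite (A X) ∧ MVAlgebra.IsChain (A X)) ∧
          Nonempty (MVAlgebra.Embedding M ((U : Filter (FinSubsets α)).Product A))) ∧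
        ((MVAlgebra.zero : M) ≠ MVAlgebra.one →
          Nonempty (MVAlgebra.Embedding M
            ((U : Filter (FinSubsets α)).Product fun _ => Set.Icc (0 : ℚ) 1)) ∧
          Nonempty (MVAlgebra.Embedding M
            ((U : Filter (FinSubsets α)).Product fun _ => Set.Icc (0 : ℝ) 1))) := by
  refine ⟨exists_containsCones α, fun U hU => ⟨hU.isAlphaRegular, fun M _ hM hcard => ?_⟩⟩
  rw [← Cardinal.mk_ord_toType α, Cardinal.lift_mk_le'] at hcard
  obtain ⟨i⟩ := hcard
  let S : FinSubsets α → Set M := fun X => i ⁻¹' X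
  have S_fin (X : FinSubsets α) : (S X).Finite := X.finite_toSet.preimage i.injective.injOn
  have hS (x : M) : ∀ᶠ X in U, x ∈ S X :=
    Filter.mem_of_superset (hU {i x}) fun Y hY => Finset.singleton_subset_iff.1 hY
  have hpart (X : FinSubsets α) : ∃ N : ℕ, ((MVAlgebra.zero : M) ≠ MVAlgebra.one → 0 < N) ∧
      ∃ k : M → Set.Icc (0 : ℤ) N, MVAlgebra.IsPartialEmbedding (S X) k := by
    -- The trivial chain goes to the one-element chain `N = 0`; positivity of `N` is needed only to
    -- divide by it.
    by_cases h01 : (MVAlgebra.zero : M) = MVAlgebra.one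
    · have := MVAlgebra.subsingleton_of_zero_eq_one h01
      have (x y : Set.Icc (0 : ℤ) (0 : ℕ)) : x = y :=
        Subtype.ext (le_antisymm (x.2.2.trans y.2.1) (y.2.2.trans x.2.1))
      exact ⟨0, fun h => absurd h01 h, fun _ => MVAlgebra.zero,
        fun _ _ _ _ _ => Subsingleton.elim _ _, fun _ _ _ _ _ => this _ _, fun _ _ _ => this _ _,
        fun _ => rfl⟩
    · obtain ⟨N, hN, hk⟩ := hM.exists_isPartialEmbedding h01 (S_fin X)
      exact ⟨N, fun _ => hN, hk⟩
  choose N hN k hk using hpart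
  refine ⟨⟨fun X => Set.Icc (0 : ℤ) (N X), fun X => inferInstance, fun X =>
    ⟨(Set.finite_Icc _ _).to_subtype, MVAlgebra.isChain_intInterval _⟩,
    MVAlgebra.nonempty_embedding_ultraproduct U hS hk⟩, fun h01 => ⟨?_, ?_⟩⟩
  · exact MVAlgebra.nonempty_embedding_ultraproduct U hS fun X =>
      (hk X).comp (MVAlgebra.intIntervalEmbedding ℚ (hN X h01))
  · exact MVAlgebra.nonempty_embedding_ultraproduct U hS fun X =>
      (hk X).comp (MVAlgebra.intIntervalEmbedding ℝ (hN X h01))
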